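/- A convex body in $\mathbb{R}^n$ is a convex compact set $K\subset\mathbb{R}^n$ with non-empty interior. Its surface area measure $S_K$ is the Borel measure on the unit sphere $\mathbb{S}^{n-1}$ given by $$S_K(\Omega)=\mathcal{H}^{n-1}\big(\{x\in\partial K:\ \exists\, u\in\Omega \text{ with } \langle x,u\rangle=h_K(u)\}\big)\qquad(\Omega\subset\mathbb{S}^{n-1}\text{ Borel}),$$ where $h_K(u)=\max_{x\in K}\langle x,u\rangle$ and $\mathcal{H}^{n-1}$ is the $(n-1)$-dimensional Hausdorff measure. A set $M$ is called homothetic to $K$ if $M=cK+x$ for some $c\ge 0$ and $x\in\mathbb{R}^n$ (so a single point is homothetic to every $K$). A convex body $K$ is called decomposable if $K=L+M$ (Minkowski sum) for some non-empty compact convex sets $L,M\subset\mathbb{R}^n$, neither of which is homothetic to $K$. A convex body $K$ is called weakly decomposable if there exists a non-empty compact convex set $M\subset\mathbb{R}^n$, not homothetic to $K$, such that $S_{K+M}$ is absolutely continuous with respect to $S_K$. **Proposition.** Every decomposable convex body in $\mathbb{R}^n$ is weakly decomposable. -/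

import Mathlib

open Set MeasureTheory
open scoped RealInnerProductSpace Pointwise ENNReal

noncomputable section

namespace WeakDecomp

/-- `ℝⁿ` with its Euclidean structure. -/
abbrev Space (n : ℕ) : Type := EuclideanSpace ℝ (Fin n)

/-- The unit sphere `S^{n-1}` of `ℝⁿ`. -/
abbrev Sphere (n : ℕ) : Type := Metric.sphere (0 : Space n) 1

variable {n : ℕ}

/-- The support function `h_K(u) = max {⟨x, u⟩ | x ∈ K}` of a nonempty compact convex set. -/
def supportFunction (K : ConvexBody (Space n)) (u : Space n) : ℝ :=
  sSup ((fun x : Space n => ⟪x, u⟫) '' (K : Set (Space n)))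

/-- The inverse spherical image `τ(K, Ω)`: the boundary points of `K` that have an outer unit
normal vector in `Ω`. -/
def inverseSphericalImage (K : ConvexBody (Space n)) (Ω : Set (Sphere n)) : Set (Space n) :=
  {x | x ∈ frontier (K : Set (Space n)) ∧
    ∃ u ∈ Ω, ⟪x, (u : Space n)⟫ = supportFunction K (u : Space n)}

theorem inner_eq_supportFunction_iff (K : ConvexBody (Space n)) {x : Space n} (hx : x ∈ K)
    (u : Space n) :
    ⟪x, u⟫ = supportFunction K u ↔ ∀ z ∈ K, ⟪z, u⟫ ≤ ⟪x, u⟫ := by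
  have hbdd : BddAbove ((fun x : Space n => ⟪x, u⟫) '' (K : Set (Space n))) :=
    (K.isCompact.image (by fun_prop)).bddAbove
  constructor
  · intro h z hz
    rw [h]
    exact le_csSup hbdd ⟨z, hz, rfl⟩
  · intro h
    apply le_antisymm
    · exact le_csSup hbdd ⟨x, hx, rfl⟩
    · apply csSup_le (K.nonempty.image _)
      rintro _ ⟨z, hz, rfl⟩
      exact h z hz

theorem mem_inverseSphericalImage (K : ConvexBody (Space n)) (Ω : Set (Sphere n)) (x : Space n) :
    x ∈ inverseSphericalImage K Ω ↔ x ∈ frontier (K : Set (Space n)) ∧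
      ∃ u ∈ Ω, ∀ z ∈ K, ⟪z, (u : Space n)⟫ ≤ ⟪x, (u : Space n)⟫ := by
  refine and_congr_right fun hx => exists_congr fun u => and_congr_right fun _ => ?_
  exact inner_eq_supportFunction_iff K (K.isClosed.frontier_subset hx) u

theorem inverseSphericalImage_empty (K : ConvexBody (Space n)) :
    inverseSphericalImage K ∅ = ∅ := by
  ext x
  simp [inverseSphericalImage]

theorem inverseSphericalImage_mono (K : ConvexBody (Space n)) {A B : Set (Sphere n)}
    (h : A ⊆ B) : inverseSphericalImage K A ⊆ inverseSphericalImage K B := by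
  rintro x ⟨hx, u, hu, hxu⟩
  exact ⟨hx, u, h hu, hxu⟩

theorem inverseSphericalImage_union (K : ConvexBody (Space n)) (A B : Set (Sphere n)) :
    inverseSphericalImage K (A ∪ B) =
      inverseSphericalImage K A ∪ inverseSphericalImage K B := by
  ext x
  simp only [inverseSphericalImage, mem_ofPred_eq, mem_union]
  grind

theorem inverseSphericalImage_iUnion (K : ConvexBody (Space n)) (A : ℕ → Set (Sphere n)) :
    inverseSphericalImage K (⋃ i, A i) = ⋃ i, inverseSphericalImage K (A i) := by
  ext x
  simp only [inverseSphericalImage, mem_ofPred_eq, mem_iUnion]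
  grind

theorem isClosed_inverseSphericalImage (K : ConvexBody (Space n)) {C : Set (Sphere n)}
    (hC : IsClosed C) : IsClosed (inverseSphericalImage K C) := by
  have h1 : IsClosed {p : Space n × Sphere n | p.2 ∈ C ∧
      ∀ z ∈ K, ⟪z, (p.2 : Space n)⟫ ≤ ⟪p.1, (p.2 : Space n)⟫} := by
    refine (hC.preimage continuous_snd).inter ?_
    have : {p : Space n × Sphere n | ∀ z ∈ K, ⟪z, (p.2 : Space n)⟫ ≤ ⟪p.1, (p.2 : Space n)⟫} =
        ⋂ z ∈ K, {p : Space n × Sphere n | ⟪z, (p.2 : Space n)⟫ ≤ ⟪p.1, (p.2 : Space n)⟫} := by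
      ext p
      simp
    change IsClosed {p : Space n × Sphere n | ∀ z ∈ K,
      ⟪z, (p.2 : Space n)⟫ ≤ ⟪p.1, (p.2 : Space n)⟫}
    rw [this]
    refine isClosed_iInter fun z => isClosed_iInter fun _ => ?_
    exact isClosed_le (by fun_prop) (by fun_prop)
  have h2 := isClosedMap_fst_of_compactSpace _ h1
  convert isClosed_frontier (s := (K : Set (Space n))) |>.inter h2 using 1
  ext x
  rw [mem_inverseSphericalImage]
  simp

/-- The boundary points of `K` with at least two outer unit normal vectors. -/
def singularPoints (K : ConvexBody (Space n)) : Set (Space n) :=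
  {x | x ∈ K ∧ ∃ u v : Sphere n, u ≠ v ∧ (∀ z ∈ K, ⟪z, (u : Space n)⟫ ≤ ⟪x, (u : Space n)⟫) ∧
    ∀ z ∈ K, ⟪z, (v : Space n)⟫ ≤ ⟪x, (v : Space n)⟫}

/-- A coordinate plane of codimension two. -/
def coordFlat (i j : Fin n) (a b : ℝ) : Set (Space n) := {y | y i = a ∧ y j = b}

theorem dimH_coordFlat_le {i j : Fin n} (hij : i ≠ j) (a b : ℝ) :
    dimH (coordFlat i j a b) ≤ ((n - 2 : ℕ) : ℝ≥0∞) := by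
  let f : ({k : Fin n // k ≠ i ∧ k ≠ j} → ℝ) → Space n := fun y =>
    WithLp.toLp 2 fun k => if h : k ≠ i ∧ k ≠ j then y ⟨k, h⟩ else if k = i then a else b
  have hf : ContDiff ℝ 1 f := by
    rw [contDiff_euclidean]
    intro k
    by_cases h : k ≠ i ∧ k ≠ j
    · simp only [f, dif_pos h]
      fun_prop
    · simp only [f, dif_neg h]
      fun_prop
  have hsub : coordFlat i j a b ⊆ range f := by
    rintro y ⟨h1, h2⟩
    refine ⟨fun k => y k, ?_⟩
    ext k
    simp only [f]
    by_cases hi : k = i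
    · subst hi; simp [h1]
    · by_cases hj : k = j
      · subst hj; simp [h2, hi]
      · simp [hi, hj]
  refine (dimH_mono hsub).trans (hf.dimH_range_le.trans ?_)
  rw [Module.finrank_fintype_fun_eq_card]
  have : Fintype.card {k : Fin n // k ≠ i ∧ k ≠ j} = n - 2 := by
    rw [Fintype.card_subtype]
    have : (Finset.univ.filter fun k : Fin n => k ≠ i ∧ k ≠ j) = ({i, j} : Finset (Fin n))ᶜ := by
      ext k; simp
    rw [this, Finset.card_compl, Finset.card_pair hij, Fintype.card_fin]
  rw [this]

/-- The points `y` whose nearest point in `K` is `x`. -/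
def IsNearest (K : ConvexBody (Space n)) (y x : Space n) : Prop :=
  x ∈ K ∧ ∀ z ∈ K, ⟪z - x, y - x⟫ ≤ 0

theorem IsNearest.dist_le {K : ConvexBody (Space n)} {y x y' x' : Space n}
    (h : IsNearest K y x) (h' : IsNearest K y' x') : dist x x' ≤ dist y y' := by
  rw [dist_eq_norm, dist_eq_norm]
  have h1 := h.2 x' h'.1
  have h2 := h'.2 x h.1
  have key : ‖x - x'‖ ^ 2 ≤ ⟪x - x', y - y'⟫ := by
    rw [← real_inner_self_eq_norm_sq]
    have e : ⟪x - x', y - y'⟫ = ⟪x - x', x - x'⟫ - ⟪x' - x, y - x⟫ - ⟪x - x', y' - x'⟫ := by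
      simp only [inner_sub_left, inner_sub_right]
      ring
    rw [e]; linarith
  have h3 := real_inner_le_norm (x - x') (y - y')
  by_contra hlt
  push Not at hlt
  have := norm_nonneg (y - y')
  nlinarith

theorem exists_minor_ne_zero (K : ConvexBody (Space n))
    (hK : (interior (K : Set (Space n))).Nonempty) {x : Space n} {u v : Sphere n}
    (huv : u ≠ v)
    (hu : ∀ z ∈ K, ⟪z, (u : Space n)⟫ ≤ ⟪x, (u : Space n)⟫)
    (hv : ∀ z ∈ K, ⟪z, (v : Space n)⟫ ≤ ⟪x, (v : Space n)⟫) :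
    ∃ i j : Fin n, (u : Space n) i * (v : Space n) j - (u : Space n) j * (v : Space n) i ≠ 0 := by
  by_contra hcon
  push Not at hcon
  have hun : ‖(u : Space n)‖ = 1 := by simp
  have hvn : ‖(v : Space n)‖ = 1 := by simp
  have hu0 : (u : Space n) ≠ 0 := by
    intro h; rw [h] at hun; simp at hun
  obtain ⟨i, hi⟩ : ∃ i, (u : Space n) i ≠ 0 := by
    by_contra h
    push Not at h
    exact hu0 (by ext k; simp [h k])
  obtain ⟨c, hc⟩ : ∃ c : ℝ, (v : Space n) = c • (u : Space n) := by
    refine ⟨(v : Space n) i / (u : Space n) i, ?_⟩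
    ext j
    have := hcon i j
    simp only [PiLp.smul_apply, smul_eq_mul]
    field_simp
    linarith
  have hc1 : |c| = 1 := by
    rw [hc, norm_smul, hun, mul_one] at hvn
    simpa using hvn
  rcases (abs_eq (zero_le_one' ℝ)).1 hc1 with rfl | rfl
  · exact huv (Subtype.ext (by simpa using hc.symm))
  · have heq : ∀ z ∈ K, ⟪z, (u : Space n)⟫ = ⟪x, (u : Space n)⟫ := by
      intro z hz
      refine le_antisymm (hu z hz) ?_
      have := hv z hz
      rw [hc] at this
      simpa using this
    obtain ⟨p, hp⟩ := hK
    obtain ⟨ε, hε, hball⟩ := Metric.isOpen_iff.1 isOpen_interior p hp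
    have hq : p + (ε / 2) • (u : Space n) ∈ K := by
      apply interior_subset (hball _)
      rw [Metric.mem_ball, dist_eq_norm, add_sub_cancel_left, norm_smul, hun]
      rw [Real.norm_of_nonneg (by positivity)]
      linarith
    have h1 := heq _ hq
    have h2 := heq p (interior_subset hp)
    rw [inner_add_left, h2, inner_smul_left, real_inner_self_eq_norm_sq, hun] at h1
    simp at h1
    exact hε.ne' h1

theorem exists_rat_normal (p q a b c d : ℝ) (hD : a * d - b * c ≠ 0) :
    ∃ (r₁ r₂ : ℚ) (s t : ℝ), 0 ≤ s ∧ 0 ≤ t ∧ p + (s * a + t * c) = r₁ ∧ q + (s * b + t * d) = r₂ := by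
  obtain ⟨e, he⟩ : ∃ e : ℝ, (a * d - b * c) * e = 1 := ⟨_, mul_inv_cancel₀ hD⟩
  let S : ℝ × ℝ → ℝ := fun w => ((w.1 - p) * d - (w.2 - q) * c) * e
  let T : ℝ × ℝ → ℝ := fun w => (a * (w.2 - q) - b * (w.1 - p)) * e
  have hopen : IsOpen {w : ℝ × ℝ | 0 < S w ∧ 0 < T w} := by
    have hS : Continuous S := by fun_prop
    have hT : Continuous T := by fun_prop
    exact (isOpen_lt continuous_const hS).inter (isOpen_lt continuous_const hT)
  have hne : {w : ℝ × ℝ | 0 < S w ∧ 0 < T w}.Nonempty := by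
    refine ⟨(p + (a + c), q + (b + d)), ?_, ?_⟩
    · have : S (p + (a + c), q + (b + d)) = 1 := by
        simp only [S]
        linear_combination he
      rw [this]; exact one_pos
    · have : T (p + (a + c), q + (b + d)) = 1 := by
        simp only [T]
        linear_combination he
      rw [this]; exact one_pos
  have hdense : DenseRange (Prod.map ((↑) : ℚ → ℝ) ((↑) : ℚ → ℝ)) :=
    Rat.denseRange_cast.prodMap Rat.denseRange_cast
  obtain ⟨⟨r₁, r₂⟩, h1, h2⟩ := hdense.exists_mem_open hopen hne
  refine ⟨r₁, r₂, _, _, h1.le, h2.le, ?_, ?_⟩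
  · simp only [S, T, Prod.map]
    linear_combination ((r₁ : ℝ) - p) * he
  · simp only [S, T, Prod.map]
    linear_combination ((r₂ : ℝ) - q) * he

theorem dimH_singularPoints_le (K : ConvexBody (Space n))
    (hK : (interior (K : Set (Space n))).Nonempty) :
    dimH (singularPoints K) ≤ ((n - 2 : ℕ) : ℝ≥0∞) := by
  classical
  let D : Set (Space n) := {y | ∃ x, IsNearest K y x}
  let P : Space n → Space n := fun y => if h : ∃ x, IsNearest K y x then h.choose else 0
  have hP : ∀ y ∈ D, IsNearest K y (P y) := by
    intro y hy
    have hy' : ∃ x, IsNearest K y x := hy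
    simp only [P, hy', ↓reduceDIte]
    exact hy'.choose_spec
  have hlip : LipschitzOnWith 1 P D := by
    refine LipschitzOnWith.of_dist_le_mul fun y hy y' hy' => ?_
    simpa using (hP y hy).dist_le (hP y' hy')
  have hsub : singularPoints K ⊆ ⋃ w : {ij : Fin n × Fin n // ij.1 ≠ ij.2} × (ℚ × ℚ),
      P '' (D ∩ coordFlat w.1.1.1 w.1.1.2 w.2.1 w.2.2) := by
    rintro x ⟨hx, u, v, huv, hu, hv⟩
    obtain ⟨i, j, hD⟩ := exists_minor_ne_zero K hK huv hu hv
    have hij : i ≠ j := by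
      rintro rfl
      exact hD (sub_self _)
    obtain ⟨r₁, r₂, s, t, hs, ht, h1, h2⟩ := exists_rat_normal (x i) (x j) _ _ _ _ hD
    refine mem_iUnion.2 ⟨(⟨(i, j), hij⟩, (r₁, r₂)), ?_⟩
    have hnear : IsNearest K (x + (s • (u : Space n) + t • (v : Space n))) x := by
      refine ⟨hx, fun z hz => ?_⟩
      rw [add_sub_cancel_left, inner_add_right, inner_smul_right, inner_smul_right,
        inner_sub_left, inner_sub_left]
      have := mul_nonneg hs (sub_nonneg.2 (hu z hz))
      have := mul_nonneg ht (sub_nonneg.2 (hv z hz))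
      linarith
    refine ⟨_, ⟨⟨x, hnear⟩, by simpa using h1, by simpa using h2⟩, ?_⟩
    have := (hP _ ⟨x, hnear⟩).dist_le hnear
    rw [dist_self] at this
    exact dist_le_zero.1 this
  refine (dimH_mono hsub).trans ?_
  rw [dimH_iUnion]
  refine iSup_le fun w => ?_
  refine (hlip.mono inter_subset_left).dimH_image_le.trans ?_
  exact (dimH_mono inter_subset_right).trans (dimH_coordFlat_le w.1.2 _ _)

/-- A full-dimensional convex body has `ℋⁿ⁻¹`-almost everywhere a unique outer unit normal. -/
theorem hausdorff_singularPoints (K : ConvexBody (Space n))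
    (hK : (interior (K : Set (Space n))).Nonempty) : μHE[n - 1] (singularPoints K) = 0 := by
  rcases lt_or_ge n 2 with hn | hn
  · have : singularPoints K = ∅ := by
      rw [eq_empty_iff_forall_notMem]
      rintro x ⟨hx, u, v, huv, hu, hv⟩
      obtain ⟨i, j, hD⟩ := exists_minor_ne_zero K hK huv hu hv
      have : i = j := by
        apply Fin.ext
        omega
      subst this
      exact hD (sub_self _)
    rw [this, measure_empty]
  · rw [Measure.euclideanHausdorffMeasure_def, Measure.smul_apply]
    have h : μH[((n - 1 : ℕ) : ℝ)] (singularPoints K) = 0 := by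
      have := hausdorffMeasure_of_dimH_lt (s := singularPoints K) (d := ((n - 1 : ℕ) : NNReal)) ?_
      · rwa [NNReal.coe_natCast] at this
      · refine (dimH_singularPoints_le K hK).trans_lt ?_
        simp only [ENNReal.coe_natCast, Nat.cast_lt]
        omega
    rw [h, smul_zero]

/-- The outer measure `Ω ↦ ℋⁿ⁻¹(τ(K, Ω))` on the sphere. -/
def surfaceAreaOuterMeasure (K : ConvexBody (Space n)) : OuterMeasure (Sphere n) where
  measureOf Ω := μHE[n - 1] (inverseSphericalImage K Ω)
  empty := by rw [inverseSphericalImage_empty, measure_empty]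
  mono h := measure_mono (inverseSphericalImage_mono K h)
  iUnion_nat s _ := by
    rw [inverseSphericalImage_iUnion]
    exact measure_iUnion_le _

theorem surfaceAreaOuterMeasure_apply (K : ConvexBody (Space n)) (Ω : Set (Sphere n)) :
    surfaceAreaOuterMeasure K Ω = μHE[n - 1] (inverseSphericalImage K Ω) := rfl

theorem isMetric_surfaceAreaOuterMeasure (K : ConvexBody (Space n))
    (hK : (interior (K : Set (Space n))).Nonempty) : (surfaceAreaOuterMeasure K).IsMetric := by
  rintro A B ⟨r, hr, hAB⟩
  simp only [surfaceAreaOuterMeasure_apply]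
  rw [inverseSphericalImage_union]
  refine le_antisymm (measure_union_le _ _) ?_
  have hmeas := (isClosed_inverseSphericalImage K (isClosed_closure (s := A))).measurableSet
  rw [← measure_inter_add_sdiff (inverseSphericalImage K A ∪ inverseSphericalImage K B) hmeas]
  refine add_le_add (measure_mono fun x hx =>
    ⟨Or.inl hx, inverseSphericalImage_mono K subset_closure hx⟩) ?_
  rw [← measure_sdiff_null (s := inverseSphericalImage K B) (hausdorff_singularPoints K hK)]
  refine measure_mono ?_
  rintro x ⟨hxB, hxs⟩
  refine ⟨Or.inr hxB, fun hxA => hxs ?_⟩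
  rw [mem_inverseSphericalImage] at hxA hxB
  obtain ⟨hx, u, hu, hxu⟩ := hxA
  obtain ⟨-, v, hv, hxv⟩ := hxB
  refine ⟨K.isClosed.frontier_subset hx, u, v, ?_, hxu, hxv⟩
  rintro rfl
  obtain ⟨w, hw, hwu⟩ := EMetric.mem_closure_iff.1 hu r (pos_iff_ne_zero.2 hr)
  rw [edist_comm] at hwu
  exact absurd hwu (not_lt.2 (hAB w hw u hv))

/-- The surface area measure `S_K` on `S^{n-1}` of a convex compact set with nonempty interior;
`surfaceAreaMeasure_apply` gives its values on Borel sets. -/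
def surfaceAreaMeasure (K : ConvexBody (Space n))
    (hK : (interior (K : Set (Space n))).Nonempty) : Measure (Sphere n) :=
  (surfaceAreaOuterMeasure K).toMeasure (by
    rw [BorelSpace.measurable_eq (α := Sphere n)]
    exact (isMetric_surfaceAreaOuterMeasure K hK).borel_le_caratheodory)

/-- `S_K(Ω) = ℋⁿ⁻¹(τ(K, Ω))` for every Borel set `Ω`. -/
theorem surfaceAreaMeasure_apply (K : ConvexBody (Space n))
    (hK : (interior (K : Set (Space n))).Nonempty) {Ω : Set (Sphere n)} (hΩ : MeasurableSet Ω) :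
    surfaceAreaMeasure K hK Ω = μHE[n - 1] (inverseSphericalImage K Ω) :=
  toMeasure_apply _ _ hΩ

/-- `M` is homothetic to `K`: `M = c K + x` for some `c ≥ 0` and some vector `x`. The value `c = 0`
is allowed, so that a single point is (degenerately) homothetic to every `K`. -/
def IsHomothetic (M K : ConvexBody (Space n)) : Prop :=
  ∃ c : ℝ, 0 ≤ c ∧ ∃ x : Space n,
    (M : Set (Space n)) = (fun y : Space n => c • y + x) '' (K : Set (Space n))

/-- `K` is decomposable: `K = L + M` for nonempty compact convex sets `L`, `M`, neither of which is
homothetic to `K`. -/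
def IsDecomposable (K : ConvexBody (Space n)) : Prop :=
  ∃ L M : ConvexBody (Space n), K = L + M ∧ ¬ IsHomothetic L K ∧ ¬ IsHomothetic M K

theorem interior_add_nonempty (K M : ConvexBody (Space n))
    (hK : (interior (K : Set (Space n))).Nonempty) :
    (interior ((K + M : ConvexBody (Space n)) : Set (Space n))).Nonempty := by
  rw [ConvexBody.coe_add]
  exact (hK.add M.nonempty).mono subset_interior_add_left

/-- `K` is weakly decomposable: there is a nonempty compact convex set `M`, not homothetic to `K`,
such that `S_{K+M}` is absolutely continuous with respect to `S_K`. -/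
def IsWeaklyDecomposable (K : ConvexBody (Space n))
    (hK : (interior (K : Set (Space n))).Nonempty) : Prop :=
  ∃ M : ConvexBody (Space n), ¬ IsHomothetic M K ∧
    (surfaceAreaMeasure (K + M) (interior_add_nonempty K M hK)).AbsolutelyContinuous
      (surfaceAreaMeasure K hK)

end WeakDecomp

end

/-!
If `K = L + M`, then `2K = (K + M) + L`, so everything rests on the fact that the surface area
measure of a summand is dominated by that of the sum: `S_B ≪ S_{B + C}`
(`absolutelyContinuous_surfaceAreaMeasure_add`). Applied to `B = K + M` and `C = L` it gives
`S_{K + M} ≪ S_{2K}`, and `S_{2K} ≪ S_K` by scaling.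

No mixed area measures are needed. When `C` is a polytope `P`, cut the sphere into finitely many
Borel pieces on each of which one vertex `p` of `P` is a maximizer of `⟪·, u⟫`. Over such a piece
the inverse spherical image of `B`, translated by `p`, lies in that of `B + P`, and summing over the
pieces gives `S_B ≤ S_{B + P}` (`surfaceAreaMeasure_le_add`).

For general `C`, let `Ω` be a closed set of directions within a cap around a unit vector `e` with
`S_{B + C}(Ω) = 0`. Over a cap, orthogonal projection to `eᗮ` distorts distances on the boundary by
at most a constant factor (`norm_sub_le_of_mem_inverseSphericalImage`). Hence the projection of
`τ(B + C, Ω)` is a compact null set of `eᗮ`, contained in an open set `U` of small measure. For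
polytopes `P ⊆ C` close enough to `C`, compactness forces the projection of `τ(B + P, Ω)` into `U`,
so that `S_B(Ω) ≤ S_{B + P}(Ω)` is arbitrarily small. Inner regularity of the finite measure `S_B`
passes from closed sets to Borel sets.
-/

open Set MeasureTheory Topology
open scoped RealInnerProductSpace Pointwise ENNReal

namespace WeakDecomp

variable {n : ℕ}

/-! ### Inverse spherical images -/

/-- A point of `K` at which a nonzero linear functional attains its maximum over `K` is
automatically a boundary point. -/
theorem mem_inverseSphericalImage_iff (K : ConvexBody (Space n)) (Ω : Set (Sphere n))
    (x : Space n) :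
    x ∈ inverseSphericalImage K Ω ↔
      x ∈ K ∧ ∃ u ∈ Ω, ∀ z ∈ K, ⟪z, (u : Space n)⟫ ≤ ⟪x, (u : Space n)⟫ := by
  rw [mem_inverseSphericalImage]
  refine ⟨fun h => ⟨K.isClosed.frontier_subset h.1, h.2⟩, ?_⟩
  rintro ⟨hx, u, hu, hmax⟩
  refine ⟨⟨subset_closure hx, fun hint => ?_⟩, u, hu, hmax⟩
  obtain ⟨ε, hε, hball⟩ := Metric.isOpen_iff.1 isOpen_interior x hint
  have hun : ‖(u : Space n)‖ = 1 := by simp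
  have hq : x + (ε / 2) • (u : Space n) ∈ K := by
    apply interior_subset (hball _)
    rw [Metric.mem_ball, dist_eq_norm, add_sub_cancel_left, norm_smul, hun,
      Real.norm_of_nonneg (by positivity)]
    linarith
  have h1 := hmax _ hq
  rw [inner_add_left, real_inner_smul_left, real_inner_self_eq_norm_sq, hun] at h1
  linarith

theorem isCompact_inverseSphericalImage (K : ConvexBody (Space n)) {C : Set (Sphere n)}
    (hC : IsClosed C) : IsCompact (inverseSphericalImage K C) :=
  K.isCompact.of_isClosed_subset (isClosed_inverseSphericalImage K hC)
    fun _ hx => ((mem_inverseSphericalImage_iff K C _).1 hx).1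

theorem continuous_supportFunction (K : ConvexBody (Space n)) :
    Continuous (supportFunction K) :=
  K.isCompact.continuous_sSup (f := fun u x : Space n => ⟪x, u⟫) (by fun_prop)

/-- Stability of the inverse spherical image over a closed set of directions: points of `K` that
almost maximize some `⟪·, u⟫` with `u ∈ C` lie in any prescribed neighbourhood of `τ(K, C)`. -/
theorem exists_pos_forall_almost_maximizer_mem (K : ConvexBody (Space n)) {C : Set (Sphere n)}
    (hC : IsClosed C) {V : Set (Space n)} (hV : IsOpen V)
    (hsub : inverseSphericalImage K C ⊆ V) :
    ∃ η > 0, ∀ x ∈ K, ∀ u ∈ C,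
      (∀ z ∈ K, ⟪z, (u : Space n)⟫ ≤ ⟪x, (u : Space n)⟫ + η) → x ∈ V := by
  have hbdd (u : Space n) : BddAbove ((fun x : Space n => ⟪x, u⟫) '' (K : Set (Space n))) :=
    (K.isCompact.image (by fun_prop)).bddAbove
  have hcpt : IsCompact (((K : Set (Space n)) \ V) ×ˢ C) :=
    (K.isCompact.diff hV).prod hC.isCompact
  have hcont : Continuous fun p : Space n × Sphere n =>
      supportFunction K (p.2 : Space n) - ⟪p.1, (p.2 : Space n)⟫ :=
    ((continuous_supportFunction K).comp (by fun_prop)).sub (by fun_prop)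
  obtain ⟨a, ha, hle⟩ := hcpt.exists_forall_le' hcont.continuousOn (a := 0) (by
    rintro ⟨x, u⟩ ⟨⟨hx, hxV⟩, hu⟩
    have hle : ⟪x, (u : Space n)⟫ ≤ supportFunction K (u : Space n) :=
      le_csSup (hbdd _) ⟨x, hx, rfl⟩
    refine sub_pos.2 (lt_of_le_of_ne hle fun heq => hxV (hsub ?_))
    exact (mem_inverseSphericalImage_iff K C x).2
      ⟨hx, u, hu, (inner_eq_supportFunction_iff K hx _).1 heq⟩)
  refine ⟨a / 2, half_pos ha, fun x hx u hu hz => ?_⟩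
  by_contra hxV
  have h1 := hle (x, u) ⟨⟨hx, hxV⟩, hu⟩
  have h2 : supportFunction K (u : Space n) ≤ ⟪x, (u : Space n)⟫ + a / 2 := by
    apply csSup_le (K.nonempty.image _)
    rintro _ ⟨z, hzK, rfl⟩
    exact hz z hzK
  dsimp only at h1
  linarith

/-! ### Projection along the axis of a cap -/

/-- The closed spherical cap of directions making an angle of at most `π / 3` with `e`. -/
def cap (e : Sphere n) : Set (Sphere n) := {u | 1 / 2 ≤ ⟪(e : Space n), (u : Space n)⟫}

theorem isClosed_cap (e : Sphere n) : IsClosed (cap e) :=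
  isClosed_le (by fun_prop) (by fun_prop)

theorem cap_mem_nhds (e : Sphere n) : cap e ∈ 𝓝 e := by
  have hopen : IsOpen {u : Sphere n | 1 / 2 < ⟪(e : Space n), (u : Space n)⟫} :=
    isOpen_lt (by fun_prop) (by fun_prop)
  refine Filter.mem_of_superset (hopen.mem_nhds ?_) fun u hu =>
    le_of_lt (show 1 / 2 < ⟪(e : Space n), (u : Space n)⟫ from hu)
  have hen : ‖(e : Space n)‖ = 1 := by simp
  change 1 / 2 < ⟪(e : Space n), (e : Space n)⟫
  rw [real_inner_self_eq_norm_sq, hen]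
  norm_num

/-- The orthogonal projection onto the hyperplane `eᗮ`. -/
noncomputable abbrev proj (e : Sphere n) : Space n →L[ℝ] (ℝ ∙ (e : Space n))ᗮ :=
  (ℝ ∙ (e : Space n))ᗮ.orthogonalProjectionOnto

theorem finrank_orthogonal_sphere (e : Sphere n) :
    Module.finrank ℝ (ℝ ∙ (e : Space n))ᗮ = n - 1 := by
  have hen : ‖(e : Space n)‖ = 1 := by simp
  have he : (e : Space n) ≠ 0 := by
    intro h
    simp [h] at hen
  have h := Submodule.finrank_add_finrank_orthogonal (ℝ ∙ (e : Space n))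
  rw [finrank_span_singleton he, finrank_euclideanSpace_fin] at h
  omega

/-- If `u` and `u'` are outer normals at `x` and `x'`, then `⟪x' - x, u⟫ ≤ 0 ≤ ⟪x' - x, u'⟫`; for
normals in a cap around `e` this bounds the component of `x' - x` along `e` by the orthogonal
component. -/
theorem norm_sub_le_of_mem_inverseSphericalImage (K : ConvexBody (Space n)) (e : Sphere n)
    {x x' : Space n} (hx : x ∈ inverseSphericalImage K (cap e))
    (hx' : x' ∈ inverseSphericalImage K (cap e)) :
    ‖x - x'‖ ≤ 3 * ‖proj e x - proj e x'‖ := by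
  obtain ⟨hxK, u, hu, hmax⟩ := (mem_inverseSphericalImage_iff K _ x).1 hx
  obtain ⟨hxK', u', hu', hmax'⟩ := (mem_inverseSphericalImage_iff K _ x').1 hx'
  have hen : ‖(e : Space n)‖ = 1 := by simp
  have hun : ‖(u : Space n)‖ = 1 := by simp
  have hun' : ‖(u' : Space n)‖ = 1 := by simp
  set d := x - x' with hd
  set c := ⟪(e : Space n), d⟫ with hc
  set p : Space n := (proj e d : Space n) with hp
  have hdec : d = c • (e : Space n) + p := by
    have h1 := (ℝ ∙ (e : Space n)).starProjection_add_starProjection_orthogonal d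
    rw [Submodule.starProjection_unit_singleton ℝ hen] at h1
    exact h1.symm
  have hpn : ‖proj e x - proj e x'‖ = ‖p‖ := by
    rw [← map_sub]
    rfl
  have h1 : 0 ≤ c * ⟪(e : Space n), (u : Space n)⟫ + ⟪p, (u : Space n)⟫ := by
    rw [← real_inner_smul_left, ← inner_add_left, ← hdec, hd, inner_sub_left]
    exact sub_nonneg.2 (hmax x' hxK')
  have h2 : c * ⟪(e : Space n), (u' : Space n)⟫ + ⟪p, (u' : Space n)⟫ ≤ 0 := by
    rw [← real_inner_smul_left, ← inner_add_left, ← hdec, hd, inner_sub_left]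
    exact sub_nonpos.2 (hmax' x hxK)
  have h3 := real_inner_le_norm p (u : Space n)
  have h4 := neg_le_of_abs_le (abs_real_inner_le_norm p (u' : Space n))
  rw [hun, mul_one] at h3
  rw [hun', mul_one] at h4
  have hu2 : 1 / 2 ≤ ⟪(e : Space n), (u : Space n)⟫ := hu
  have hu2' : 1 / 2 ≤ ⟪(e : Space n), (u' : Space n)⟫ := hu'
  have hcabs : |c| ≤ 2 * ‖p‖ := by
    have := norm_nonneg p
    rw [abs_le]
    constructor
    · by_contra! hlt
      nlinarith
    · by_contra! hlt
      nlinarith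
  calc ‖d‖ = ‖c • (e : Space n) + p‖ := by rw [← hdec]
    _ ≤ |c| + ‖p‖ := by
      refine (norm_add_le _ _).trans_eq ?_
      rw [norm_smul, hen, mul_one, Real.norm_eq_abs]
    _ ≤ 3 * ‖proj e x - proj e x'‖ := by rw [hpn]; linarith

theorem euclideanHausdorffMeasure_le_proj_image (K : ConvexBody (Space n)) (e : Sphere n)
    {Ω : Set (Sphere n)} (hΩ : Ω ⊆ cap e) (d : ℕ) :
    μHE[d] (inverseSphericalImage K Ω) ≤
      3 ^ d * μHE[d] (proj e '' inverseSphericalImage K Ω) := by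
  set T := inverseSphericalImage K Ω
  have hanti : AntilipschitzWith 3 (T.domRestrict (proj e)) :=
    AntilipschitzWith.of_le_mul_dist fun x y => by
      rw [Subtype.dist_eq, dist_eq_norm, dist_eq_norm]
      exact norm_sub_le_of_mem_inverseSphericalImage K e
        (inverseSphericalImage_mono K hΩ x.2) (inverseSphericalImage_mono K hΩ y.2)
  have h1 : μH[(d : ℝ)] T ≤ 3 ^ d * μH[(d : ℝ)] (proj e '' T) := by
    have h := hanti.le_hausdorffMeasure_image (d := d) (by positivity) univ
    rw [image_univ, range_domRestrict] at h
    rw [← isometry_subtype_coe.hausdorffMeasure_image (Or.inl (by positivity)), image_univ,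
      Subtype.range_coe] at h
    simpa using h
  rw [Measure.euclideanHausdorffMeasure_def, Measure.euclideanHausdorffMeasure_def,
    Measure.smul_apply, Measure.smul_apply, ENNReal.smul_def, ENNReal.smul_def, smul_eq_mul,
    smul_eq_mul, mul_left_comm]
  gcongr

theorem euclideanHausdorffMeasure_proj_image_eq_zero (e : Sphere n) {T : Set (Space n)} {d : ℕ}
    (hT : μHE[d] T = 0) : μHE[d] (proj e '' T) = 0 := by
  rw [Measure.euclideanHausdorffMeasure_def, Measure.smul_apply, ENNReal.smul_def, smul_eq_mul,
    mul_eq_zero] at hT ⊢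
  refine hT.imp id fun h => ?_
  refine le_antisymm (((proj e).lipschitz.hausdorffMeasure_image_le
    (d := (d : ℝ)) (by positivity) T).trans ?_) zero_le
  rw [h, mul_zero]

instance isAddHaarMeasure_orthogonal_sphere (e : Sphere n) :
    (μHE[n - 1] : Measure (ℝ ∙ (e : Space n))ᗮ).IsAddHaarMeasure := by
  rw [← finrank_orthogonal_sphere e]
  infer_instance

instance isFiniteMeasure_surfaceAreaMeasure (K : ConvexBody (Space n))
    (hK : (interior (K : Set (Space n))).Nonempty) :
    IsFiniteMeasure (surfaceAreaMeasure K hK) := by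
  have : IsLocallyFiniteMeasure (surfaceAreaMeasure K hK) := by
    refine ⟨fun e => ⟨cap e, cap_mem_nhds e, ?_⟩⟩
    rw [surfaceAreaMeasure_apply K hK (isClosed_cap e).measurableSet]
    refine (euclideanHausdorffMeasure_le_proj_image K e subset_rfl (n - 1)).trans_lt ?_
    have hcpt := (isCompact_inverseSphericalImage K (isClosed_cap e)).image (proj e).continuous
    exact ENNReal.mul_lt_top (by finiteness) hcpt.measure_lt_top
  exact ⟨isCompact_univ.measure_lt_top⟩

/-! ### Adding a polytope -/

/-- To compare two measures it is enough to compare them inside each member of a countable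
measurable cover. -/
theorem measure_le_of_iUnion_eq_univ {α : Type*} [MeasurableSpace α] {μ ν : Measure α}
    {s : ℕ → Set α} (hs : ∀ i, MeasurableSet (s i)) (hcover : ⋃ i, s i = univ)
    (h : ∀ i, ∀ t ⊆ s i, MeasurableSet t → μ t ≤ ν t) : μ ≤ ν := by
  refine Measure.le_iff.2 fun t ht => ?_
  have hms : ∀ i, MeasurableSet (t ∩ disjointed s i) := fun i =>
    ht.inter (MeasurableSet.disjointed hs i)
  have hdis : Pairwise (Function.onFun Disjoint fun i => t ∩ disjointed s i) := fun i j hij =>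
    (disjoint_disjointed s hij).mono inter_subset_right inter_subset_right
  have hU : t = ⋃ i, t ∩ disjointed s i := by
    rw [← inter_iUnion, iUnion_disjointed, hcover, inter_univ]
  rw [hU, measure_iUnion hdis hms, measure_iUnion hdis hms]
  exact ENNReal.tsum_le_tsum fun i =>
    h i _ (inter_subset_right.trans (disjointed_subset s i)) (hms i)

/-- The surface area measure increases when a polytope `P` is added. It is only used of `P` that
countably many of its points `f i` suffice to support it in every direction. -/
theorem surfaceAreaMeasure_le_add (B P : ConvexBody (Space n))
    (hB : (interior (B : Set (Space n))).Nonempty)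
    (hBP : (interior ((B + P : ConvexBody (Space n)) : Set (Space n))).Nonempty)
    {f : ℕ → Space n} (hf : ∀ i, f i ∈ P)
    (hmax : ∀ u : Sphere n, ∃ i, ∀ z ∈ P, ⟪z, (u : Space n)⟫ ≤ ⟪f i, (u : Space n)⟫) :
    surfaceAreaMeasure B hB ≤ surfaceAreaMeasure (B + P) hBP := by
  let s : ℕ → Set (Sphere n) := fun i =>
    {u | ∀ z ∈ P, ⟪z, (u : Space n)⟫ ≤ ⟪f i, (u : Space n)⟫}
  have hs : ∀ i, IsClosed (s i) := fun i => by
    have : s i = ⋂ z ∈ P, {u : Sphere n | ⟪z, (u : Space n)⟫ ≤ ⟪f i, (u : Space n)⟫} := by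
      ext u
      simp [s]
    rw [this]
    exact isClosed_iInter fun z => isClosed_iInter fun _ => isClosed_le (by fun_prop) (by fun_prop)
  refine measure_le_of_iUnion_eq_univ (s := s) (fun i => (hs i).measurableSet)
    (eq_univ_of_forall fun u => mem_iUnion.2 (hmax u)) fun i t hts ht => ?_
  rw [surfaceAreaMeasure_apply B hB ht, surfaceAreaMeasure_apply (B + P) hBP ht,
    ← (isometry_add_right (f i)).euclideanHausdorffMeasure_image]
  refine measure_mono ?_
  -- A normal `u` of `B` at `x` with `u ∈ t ⊆ s i` is a normal of `P` at `f i`.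
  rintro _ ⟨x, hx, rfl⟩
  obtain ⟨hxB, u, hu, hxu⟩ := (mem_inverseSphericalImage_iff B t x).1 hx
  refine (mem_inverseSphericalImage_iff (B + P) t _).2 ⟨add_mem_add hxB (hf i), u, hu, ?_⟩
  rintro _ ⟨b, hb, p, hp, rfl⟩
  rw [inner_add_left, inner_add_left]
  exact add_le_add (hxu b hb) (hts hu p hp)

/-- The convex hull of a nonempty finite set, as a convex body. -/
def polytope (t : Set (Space n)) (ht : t.Finite) (hne : t.Nonempty) : ConvexBody (Space n) where
  carrier := convexHull ℝ t
  convex' := convex_convexHull ℝ t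
  isCompact' := ht.isCompact_convexHull ℝ
  nonempty' := hne.convexHull

theorem surfaceAreaMeasure_le_add_polytope (B : ConvexBody (Space n)) {t : Set (Space n)}
    (ht : t.Finite) (hne : t.Nonempty) (hB : (interior (B : Set (Space n))).Nonempty)
    (hBP : (interior ((B + polytope t ht hne : ConvexBody (Space n)) : Set (Space n))).Nonempty) :
    surfaceAreaMeasure B hB ≤ surfaceAreaMeasure (B + polytope t ht hne) hBP := by
  obtain ⟨f, rfl⟩ := ht.countable.exists_eq_range hne
  refine surfaceAreaMeasure_le_add B _ hB hBP (f := f)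
    (fun i => subset_convexHull ℝ _ (mem_range_self i)) fun u => ?_
  obtain ⟨_, ⟨i, rfl⟩, hi⟩ := Set.exists_max_image _ (fun z : Space n => ⟪z, (u : Space n)⟫) ht hne
  refine ⟨i, fun z hz => ?_⟩
  refine convexHull_min (t := {z : Space n | ⟪z, (u : Space n)⟫ ≤ ⟪f i, (u : Space n)⟫})
    (fun z hz => hi z hz) ?_ hz
  exact convex_halfSpace_le ⟨fun x y => inner_add_left x y _,
    fun c x => real_inner_smul_left x _ c⟩ _

/-! ### Adding an arbitrary convex body -/

/-- If `C` is close to a polytope inside it, then the polytope produces inverse spherical images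
near those of `B + C`. -/
theorem exists_polytope_inverseSphericalImage_subset (B C : ConvexBody (Space n))
    {Ω : Set (Sphere n)} (hΩ : IsClosed Ω) {V : Set (Space n)} (hV : IsOpen V)
    (hsub : inverseSphericalImage (B + C) Ω ⊆ V) :
    ∃ (t : Set (Space n)) (ht : t.Finite) (hne : t.Nonempty),
      inverseSphericalImage (B + polytope t ht hne) Ω ⊆ V := by
  obtain ⟨η, hη, hmem⟩ := exists_pos_forall_almost_maximizer_mem (B + C) hΩ hV hsub
  obtain ⟨t, htC, ht, hcover⟩ := C.isCompact.finite_cover_balls hη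
  have hne : t.Nonempty := by
    obtain ⟨c, hc⟩ := C.nonempty
    obtain ⟨p, hp, -⟩ := mem_iUnion₂.1 (hcover hc)
    exact ⟨p, hp⟩
  refine ⟨t, ht, hne, fun x hx => ?_⟩
  obtain ⟨hxBP, u, hu, hmax⟩ := (mem_inverseSphericalImage_iff _ Ω x).1 hx
  have hun : ‖(u : Space n)‖ = 1 := by simp
  have hxBC : x ∈ B + C := by
    obtain ⟨b, hb, p, hp, rfl⟩ := hxBP
    exact add_mem_add hb (convexHull_min htC C.convex hp)
  refine hmem x hxBC u hu ?_
  rintro _ ⟨b, hb, c, hc, rfl⟩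
  obtain ⟨p, hp, hcp⟩ := mem_iUnion₂.1 (hcover hc)
  have h1 := hmax (b + p) (add_mem_add hb (subset_convexHull ℝ t hp))
  have h2 := real_inner_le_norm (c - p) (u : Space n)
  rw [Metric.mem_ball, dist_eq_norm] at hcp
  rw [inner_sub_left, hun] at h2
  rw [inner_add_left] at h1 ⊢
  linarith

theorem surfaceAreaMeasure_eq_zero_of_add_of_isClosed (B C : ConvexBody (Space n))
    (hB : (interior (B : Set (Space n))).Nonempty)
    (hBC : (interior ((B + C : ConvexBody (Space n)) : Set (Space n))).Nonempty)
    (e : Sphere n) {Ω : Set (Sphere n)} (hΩ : IsClosed Ω) (hcap : Ω ⊆ cap e)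
    (h0 : surfaceAreaMeasure (B + C) hBC Ω = 0) : surfaceAreaMeasure B hB Ω = 0 := by
  by_contra hpos
  rw [surfaceAreaMeasure_apply _ hBC hΩ.measurableSet] at h0
  have hr : μHE[n - 1] (proj e '' inverseSphericalImage (B + C) Ω) <
      surfaceAreaMeasure B hB Ω / 3 ^ (n - 1) := by
    rw [euclideanHausdorffMeasure_proj_image_eq_zero e h0]
    exact ENNReal.div_pos hpos (by finiteness)
  obtain ⟨U, hTU, hU, hUr⟩ := Set.exists_isOpen_lt_of_lt _ _ hr
  obtain ⟨t, ht, hne, hsub⟩ := exists_polytope_inverseSphericalImage_subset B C hΩ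
    (hU.preimage (proj e).continuous) (image_subset_iff.1 hTU)
  have hBP := interior_add_nonempty B (polytope t ht hne) hB
  have hle := surfaceAreaMeasure_le_add_polytope B ht hne hB hBP Ω
  rw [surfaceAreaMeasure_apply _ hBP hΩ.measurableSet] at hle
  refine absurd hle (not_le.2 ?_)
  refine (euclideanHausdorffMeasure_le_proj_image _ e hcap (n - 1)).trans_lt ?_
  refine ENNReal.mul_lt_of_lt_div' ((measure_mono ?_).trans_lt hUr)
  exact image_subset_iff.2 hsub

theorem absolutelyContinuous_surfaceAreaMeasure_add (B C : ConvexBody (Space n))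
    (hB : (interior (B : Set (Space n))).Nonempty)
    (hBC : (interior ((B + C : ConvexBody (Space n)) : Set (Space n))).Nonempty) :
    surfaceAreaMeasure B hB ≪ surfaceAreaMeasure (B + C) hBC := by
  refine Measure.AbsolutelyContinuous.mk fun Ω hΩ h0 => ?_
  refine measure_null_of_locally_null Ω fun e _ =>
    ⟨Ω ∩ cap e, inter_mem_nhdsWithin Ω (cap_mem_nhds e), ?_⟩
  by_contra hpos
  obtain ⟨F, hF, hFclosed, hFpos⟩ :=
    (hΩ.inter (isClosed_cap e).measurableSet).exists_lt_isClosed_of_ne_top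
      (measure_ne_top (surfaceAreaMeasure B hB) _) (pos_iff_ne_zero.2 hpos)
  refine hFpos.ne' (surfaceAreaMeasure_eq_zero_of_add_of_isClosed B C hB hBC e hFclosed
    (hF.trans inter_subset_right) ?_)
  exact measure_mono_null (hF.trans inter_subset_left) h0

theorem absolutelyContinuous_surfaceAreaMeasure_add_self (K : ConvexBody (Space n))
    (hK : (interior (K : Set (Space n))).Nonempty)
    (hKK : (interior ((K + K : ConvexBody (Space n)) : Set (Space n))).Nonempty) :
    surfaceAreaMeasure (K + K) hKK ≪ surfaceAreaMeasure K hK := by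
  refine Measure.AbsolutelyContinuous.mk fun Ω hΩ h0 => ?_
  rw [surfaceAreaMeasure_apply _ _ hΩ] at h0 ⊢
  refine measure_mono_null (t := (2 : ℝ) • inverseSphericalImage K Ω) ?_ (by
    rw [Measure.euclideanHausdorffMeasure_smul₀ _ two_ne_zero, h0, smul_zero])
  intro x hx
  obtain ⟨⟨a, ha, b, hb, hab⟩, u, hu, hmax⟩ := (mem_inverseSphericalImage_iff _ Ω x).1 hx
  refine ⟨(1 / 2 : ℝ) • x, (mem_inverseSphericalImage_iff K Ω _).2 ⟨?_, u, hu, fun z hz => ?_⟩, ?_⟩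
  · rw [← hab, smul_add]
    exact K.convex ha hb (by norm_num) (by norm_num) (by norm_num)
  · have h := hmax (z + z) (add_mem_add hz hz)
    rw [inner_add_left] at h
    rw [real_inner_smul_left]
    linarith
  · simp

end WeakDecomp

/-- Every decomposable convex body (with nonempty interior) in `ℝⁿ` is weakly decomposable. -/
theorem proposition5p3 (n : ℕ) (K : ConvexBody (EuclideanSpace ℝ (Fin n)))
    (hK : (interior (K : Set (EuclideanSpace ℝ (Fin n)))).Nonempty)
    (hdec : WeakDecomp.IsDecomposable K) :
    WeakDecomp.IsWeaklyDecomposable K hK := by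
  obtain ⟨L, M, hLM, -, hM⟩ := hdec
  refine ⟨M, hM, ?_⟩
  have hKM := WeakDecomp.interior_add_nonempty K M hK
  have heq : K + M + L = K + K := by
    rw [add_assoc, add_comm M L, ← hLM]
  have h1 := WeakDecomp.absolutelyContinuous_surfaceAreaMeasure_add (K + M) L hKM
    (WeakDecomp.interior_add_nonempty _ L hKM)
  simp only [heq] at h1
  exact h1.trans (WeakDecomp.absolutelyContinuous_surfaceAreaMeasure_add_self K hK
    (WeakDecomp.interior_add_nonempty K K hK))
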